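/- Fix countably infinite supplies of atomic propositions and of trace variables. HyperLTL formulas are given by $\psi ::= \exists\pi.\,\psi \mid \forall\pi.\,\psi \mid \varphi$ and $\varphi ::= a_\pi \mid \neg\varphi \mid \varphi\vee\varphi \mid \bigcirc\varphi \mid \varphi\,\mathcal U\,\varphi$, with the usual semantics over sets $T$ of infinite traces; formulas are coded effectively by natural numbers. For every formula $\varphi$ let $\mathrm{AP}_\varphi$ be any set of atomic propositions containing those that occur in $\varphi$ (for instance exactly those, or all of them), let $\Sigma=2^{\mathrm{AP}_\varphi}$, and for a closed formula $\varphi$ let $\mathcal L(\varphi)\subseteq\mathcal P(\Sigma^\omega)$ be the set of all $T\subseteq\Sigma^\omega$ that satisfy $\varphi$. For $U\subseteq\Sigma^*$ and $T\subseteq\Sigma^\omega$ write $U\le T$ if every $u\in U$ is a prefix of some $t\in T$. A set $U\subseteq\Sigma^*$ is a bad prefix for a hyperproperty $S\subseteq\mathcal P(\Sigma^\omega)$ if no $T$ with $U\le T$ belongs to $S$. $S$ is a safety hyperproperty if every $T\notin S$ has a finite bad prefix $U\le T$; it is a $k$-safety hyperproperty if, moreover, every $T\notin S$ has a bad prefix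 $U\le T$ with $|U|\le k$. Then there is no algorithm that, given a closed HyperLTL formula $\varphi$, decides 1. for a fixed $k\in\mathbb N$ (whichever $k$ is fixed), whether $\mathcal L(\varphi)$ is a $k$-safety hyperproperty; 2. whether $\mathcal L(\varphi)$ is a $k$-safety hyperproperty for some $k\in\mathbb N$; 3. whether $\mathcal L(\varphi)$ is a safety hyperproperty; 4. whether $\mathcal L(\varphi)$ is a safety hyperproperty in the variant sense in which the bad prefix $U\le T$ may be an infinite set of finite traces. -/

import Mathlib

/-! ### Traces, hyperproperties and (`k`-)safety -/

namespace Hyper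

/-- Infinite traces over the alphabet `α`, positions being counted from `0`. -/
abbrev Trace (α : Type) : Type := ℕ → α

/-- A hyperproperty over the alphabet `α`: a set of sets of infinite traces. -/
abbrev Hyperproperty (α : Type) : Type := Set (Set (Trace α))

/-- The finite trace `u` is a prefix of the infinite trace `t`. -/
def IsPrefixOf {α : Type} (u : List α) (t : Trace α) : Prop :=
  ∀ (i : ℕ) (h : i < u.length), u[i] = t i

/-- `U ≤ T` for a set `U` of finite traces and a set `T` of infinite traces: every element of `U`
is a prefix of some element of `T`. -/
def SetPrefix {α : Type} (U : Set (List α)) (T : Set (Trace α)) : Prop :=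
  ∀ u ∈ U, ∃ t ∈ T, IsPrefixOf u t

/-- The set `U` of finite traces is a bad prefix for `S`: no set of infinite traces extending `U`
belongs to `S`. -/
def IsBadPrefix {α : Type} (S : Hyperproperty α) (U : Set (List α)) : Prop :=
  ∀ T : Set (Trace α), SetPrefix U T → T ∉ S

/-- Safety hyperproperties: every violating set of traces has a finite bad prefix. -/
def IsSafety {α : Type} (S : Hyperproperty α) : Prop :=
  ∀ T : Set (Trace α), T ∉ S →
    ∃ U : Set (List α), U.Finite ∧ SetPrefix U T ∧ IsBadPrefix S U

/-- The variant of safety in which a bad prefix may be an infinite set of finite traces. -/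
def IsWeakSafety {α : Type} (S : Hyperproperty α) : Prop :=
  ∀ T : Set (Trace α), T ∉ S → ∃ U : Set (List α), SetPrefix U T ∧ IsBadPrefix S U

/-- `k`-safety hyperproperties: safety hyperproperties such that every violating set of traces has
a bad prefix with at most `k` elements. -/
def IsKSafety {α : Type} (k : ℕ) (S : Hyperproperty α) : Prop :=
  IsSafety S ∧ ∀ T : Set (Trace α), T ∉ S →
    ∃ U : Set (List α), U.encard ≤ k ∧ SetPrefix U T ∧ IsBadPrefix S U

/-! ### Syntax of HyperLTL -/

/-- Quantifier-free HyperLTL formulas. Atomic propositions and trace variables are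
natural numbers; `atom a x` is the proposition `a` indexed by the trace variable `x`. -/
inductive Body : Type
  | atom (a x : ℕ) : Body
  | neg (φ : Body) : Body
  | or (φ ψ : Body) : Body
  | next (φ : Body) : Body
  | untl (φ ψ : Body) : Body

/-- HyperLTL formulas: a prefix of trace quantifiers followed by a quantifier-free formula. -/
inductive HyperLTL : Type
  | body (φ : Body) : HyperLTL
  | all (x : ℕ) (ψ : HyperLTL) : HyperLTL
  | ex (x : ℕ) (ψ : HyperLTL) : HyperLTL

/-- The trace variables occurring in a quantifier-free formula. -/
def Body.vars : Body → Set ℕ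
  | .atom _ x => {x}
  | .neg φ => φ.vars
  | .or φ ψ => φ.vars ∪ ψ.vars
  | .next φ => φ.vars
  | .untl φ ψ => φ.vars ∪ ψ.vars

/-- The atomic propositions occurring in a quantifier-free formula. -/
def Body.props : Body → Set ℕ
  | .atom a _ => {a}
  | .neg φ => φ.props
  | .or φ ψ => φ.props ∪ ψ.props
  | .next φ => φ.props
  | .untl φ ψ => φ.props ∪ ψ.props

/-- The free trace variables of a formula. -/
def HyperLTL.freeVars : HyperLTL → Set ℕ
  | .body φ => φ.vars
  | .all x ψ => ψ.freeVars \ {x}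
  | .ex x ψ => ψ.freeVars \ {x}

/-- The atomic propositions occurring in a formula. -/
def HyperLTL.props : HyperLTL → Set ℕ
  | .body φ => φ.props
  | .all _ ψ => ψ.props
  | .ex _ ψ => ψ.props

/-- Closed formulas. -/
def HyperLTL.IsSentence (φ : HyperLTL) : Prop := φ.freeVars = ∅

/-! ### Semantics of HyperLTL -/

/-- The alphabet `2^AP` for a set `AP` of atomic propositions. -/
abbrev Letter (AP : Set ℕ) : Type := Set AP

/-- Trace assignments: partial functions from trace variables to traces. -/
abbrev Assignment (AP : Set ℕ) : Type := ℕ → Option (Trace (Letter AP))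

/-- The assignment `Π[i,∞]`, in which every assigned trace is replaced by its suffix from
position `i` on. -/
def Assignment.suffix {AP : Set ℕ} (P : Assignment AP) (i : ℕ) : Assignment AP :=
  fun x => (P x).map fun t n => t (n + i)

/-- Satisfaction of quantifier-free formulas. -/
def Body.Sat {AP : Set ℕ} : Body → Assignment AP → Prop
  | .atom a x, P => ∃ t, P x = some t ∧ ∃ h : a ∈ AP, (⟨a, h⟩ : AP) ∈ t 0
  | .neg φ, P => ¬ φ.Sat P
  | .or φ ψ, P => φ.Sat P ∨ ψ.Sat P
  | .next φ, P => φ.Sat (P.suffix 1)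
  | .untl φ ψ, P => ∃ i, ψ.Sat (P.suffix i) ∧ ∀ j < i, φ.Sat (P.suffix j)

/-- Satisfaction of formulas over a set `T` of traces. -/
def HyperLTL.Sat {AP : Set ℕ} (T : Set (Trace (Letter AP))) : HyperLTL → Assignment AP → Prop
  | .body φ, P => φ.Sat P
  | .all x ψ, P => ∀ t ∈ T, ψ.Sat T (Function.update P x (some t))
  | .ex x ψ, P => ∃ t ∈ T, ψ.Sat T (Function.update P x (some t))

/-- The hyperproperty over the alphabet `2^AP` expressed by a formula: the sets of traces that
satisfy it under the empty trace assignment. -/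
def HyperLTL.lang (AP : Set ℕ) (φ : HyperLTL) : Hyperproperty (Letter AP) :=
  {T | φ.Sat T (fun _ => none)}

/-! ### Gödel numbering of formulas, and decidability -/

/-- The code of a quantifier-free formula. -/
def Body.code : Body → ℕ
  | .atom a x => 5 * Nat.pair a x
  | .neg φ => 5 * φ.code + 1
  | .or φ ψ => 5 * Nat.pair φ.code ψ.code + 2
  | .next φ => 5 * φ.code + 3
  | .untl φ ψ => 5 * Nat.pair φ.code ψ.code + 4

/-- The quantifier-free formula with a given code. -/
def Body.ofCode (n : ℕ) : Body :=
  if h0 : n % 5 = 0 then .atom (n / 5).unpair.1 (n / 5).unpair.2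
  else if n % 5 = 1 then .neg (Body.ofCode (n / 5))
  else if n % 5 = 2 then .or (Body.ofCode (n / 5).unpair.1) (Body.ofCode (n / 5).unpair.2)
  else if n % 5 = 3 then .next (Body.ofCode (n / 5))
  else .untl (Body.ofCode (n / 5).unpair.1) (Body.ofCode (n / 5).unpair.2)
termination_by n
decreasing_by
  all_goals
    have h1 := Nat.unpair_left_le (n / 5)
    have h2 := Nat.unpair_right_le (n / 5)
    omega

theorem Body.ofCode_code (φ : Body) : Body.ofCode φ.code = φ := by
  induction φ with
  | atom a x =>
    rw [Body.code, Body.ofCode, dif_pos (by omega)]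
    simp
  | neg φ ih =>
    rw [Body.code, Body.ofCode, dif_neg (by omega), if_pos (by omega),
      show (5 * φ.code + 1) / 5 = φ.code by omega, ih]
  | or φ ψ ih1 ih2 =>
    rw [Body.code, Body.ofCode, dif_neg (by omega), if_neg (by omega), if_pos (by omega),
      show (5 * Nat.pair φ.code ψ.code + 2) / 5 = Nat.pair φ.code ψ.code by omega,
      Nat.unpair_pair, ih1, ih2]
  | next φ ih =>
    rw [Body.code, Body.ofCode, dif_neg (by omega), if_neg (by omega), if_neg (by omega),
      if_pos (by omega), show (5 * φ.code + 3) / 5 = φ.code by omega, ih]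
  | untl φ ψ ih1 ih2 =>
    rw [Body.code, Body.ofCode, dif_neg (by omega), if_neg (by omega), if_neg (by omega),
      if_neg (by omega),
      show (5 * Nat.pair φ.code ψ.code + 4) / 5 = Nat.pair φ.code ψ.code by omega,
      Nat.unpair_pair, ih1, ih2]

theorem Body.code_ofCode (n : ℕ) : (Body.ofCode n).code = n := by
  induction n using Nat.strong_induction_on with
  | _ n ih =>
    have h1 := Nat.unpair_left_le (n / 5)
    have h2 := Nat.unpair_right_le (n / 5)
    rw [Body.ofCode]
    split_ifs with h h' h' h'
    · rw [Body.code, Nat.pair_unpair]; omega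
    · rw [Body.code, ih _ (by omega)]; omega
    · rw [Body.code, ih _ (by omega), ih _ (by omega), Nat.pair_unpair]; omega
    · rw [Body.code, ih _ (by omega)]; omega
    · rw [Body.code, ih _ (by omega), ih _ (by omega), Nat.pair_unpair]; omega

/-- The code of a formula. -/
def HyperLTL.code : HyperLTL → ℕ
  | .body φ => 3 * φ.code
  | .all x ψ => 3 * Nat.pair x ψ.code + 1
  | .ex x ψ => 3 * Nat.pair x ψ.code + 2

/-- The formula with a given code. -/
def HyperLTL.ofCode (n : ℕ) : HyperLTL :=
  if h0 : n % 3 = 0 then .body (Body.ofCode (n / 3))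
  else if n % 3 = 1 then .all (n / 3).unpair.1 (HyperLTL.ofCode (n / 3).unpair.2)
  else .ex (n / 3).unpair.1 (HyperLTL.ofCode (n / 3).unpair.2)
termination_by n
decreasing_by
  all_goals
    have h2 := Nat.unpair_right_le (n / 3)
    omega

theorem HyperLTL.ofCode_code (φ : HyperLTL) : HyperLTL.ofCode φ.code = φ := by
  induction φ with
  | body φ =>
    rw [HyperLTL.code, HyperLTL.ofCode, dif_pos (by omega),
      show 3 * φ.code / 3 = φ.code by omega, Body.ofCode_code]
  | all x ψ ih =>
    rw [HyperLTL.code, HyperLTL.ofCode, dif_neg (by omega), if_pos (by omega),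
      show (3 * Nat.pair x ψ.code + 1) / 3 = Nat.pair x ψ.code by omega, Nat.unpair_pair, ih]
  | ex x ψ ih =>
    rw [HyperLTL.code, HyperLTL.ofCode, dif_neg (by omega), if_neg (by omega),
      show (3 * Nat.pair x ψ.code + 2) / 3 = Nat.pair x ψ.code by omega, Nat.unpair_pair, ih]

theorem HyperLTL.code_ofCode (n : ℕ) : (HyperLTL.ofCode n).code = n := by
  induction n using Nat.strong_induction_on with
  | _ n ih =>
    have h2 := Nat.unpair_right_le (n / 3)
    rw [HyperLTL.ofCode]
    split_ifs with h h'
    · rw [HyperLTL.code, Body.code_ofCode]; omega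
    · rw [HyperLTL.code, ih _ (by omega), Nat.pair_unpair]; omega
    · rw [HyperLTL.code, ih _ (by omega), Nat.pair_unpair]; omega

/-- Formulas are coded bijectively by natural numbers through `HyperLTL.code`; this is the coding
with respect to which Mathlib's `Computable` and `ComputablePred` are understood below. -/
instance : Denumerable HyperLTL :=
  Denumerable.mk' ⟨HyperLTL.code, HyperLTL.ofCode, HyperLTL.ofCode_code, HyperLTL.code_ofCode⟩

/-- A property of HyperLTL sentences is decidable if some computable predicate on formulas agrees
with it on all sentences (its values on formulas with free trace variables do not matter). -/
def DecidableOnSentences (p : HyperLTL → Prop) : Prop :=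
  ∃ q : HyperLTL → Prop, ComputablePred q ∧ ∀ φ : HyperLTL, φ.IsSentence → (q φ ↔ p φ)

end Hyper

/-!
A weak safety hyperproperty is closed under passing to subsets, and a sentence that begins with `∃`
is violated by the empty set of traces. So such a sentence expresses a weak safety hyperproperty
only if it is unsatisfiable, in which case it expresses even a `k`-safety hyperproperty for every
`k`. It remains to reduce the halting problem to the unsatisfiability of such sentences.

A trace can describe a configuration of a Turing machine: one half of the tape is written on it as
it stands, the other half in reverse, so that a move of the head shifts both halves by one position
and is expressible with `○`. The sentence `∃ z. ∀ x. ∃ y. (init z ∧ step x y)` then says that every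
configuration reached from the initial one has a successor, that is, that the machine does not halt.
The machine is fixed, and only its input varies.
-/

namespace Hyper

open Turing

section Safety

variable {α : Type} {S : Hyperproperty α}

theorem IsSafety.isWeakSafety (h : IsSafety S) : IsWeakSafety S := fun T hT =>
  let ⟨U, _, hU⟩ := h T hT
  ⟨U, hU⟩

theorem IsWeakSafety.isLowerSet (h : IsWeakSafety S) : IsLowerSet S := fun T T' hle hT => by
  by_contra hT'
  obtain ⟨U, hU, hbad⟩ := h T' hT'
  exact hbad T (fun u hu => (hU u hu).imp fun _ ⟨ht, hut⟩ => ⟨hle ht, hut⟩) hT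

theorem isKSafety_empty (k : ℕ) : IsKSafety k (∅ : Hyperproperty α) := by
  have hbad (T : Set (Trace α)) : SetPrefix ∅ T ∧ IsBadPrefix (∅ : Hyperproperty α) ∅ :=
    ⟨fun _ hu => hu.elim, fun _ _ => id⟩
  exact ⟨fun T _ => ⟨∅, Set.finite_empty, hbad T⟩, fun T _ => ⟨∅, by simp, hbad T⟩⟩

theorem eq_empty_of_isWeakSafety_lang_ex {A : Set ℕ} {x : ℕ} {ψ : HyperLTL}
    (h : IsWeakSafety ((HyperLTL.ex x ψ).lang A)) : (HyperLTL.ex x ψ).lang A = ∅ :=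
  Set.eq_empty_of_forall_notMem fun T hT =>
    let ⟨_, ht, _⟩ := h.isLowerSet (Set.empty_subset T) hT
    ht

end Safety

section Connectives

/-- A quantifier-free formula that always holds. It mentions the trace variable `0`, which need not
be assigned a trace. -/
def Body.verum : Body := .or (.atom 0 0) (.neg (.atom 0 0))

/-- Conjunction, expressed through negation and disjunction. -/
def Body.and (φ ψ : Body) : Body := .neg (.or (.neg φ) (.neg ψ))

/-- Implication, expressed through negation and disjunction. -/
def Body.imp (φ ψ : Body) : Body := .or (.neg φ) ψ

/-- Equivalence, expressed as a conjunction of implications. -/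
def Body.iff (φ ψ : Body) : Body := (φ.imp ψ).and (ψ.imp φ)

/-- The temporal operator `□`, expressed through `𝒰`. -/
def Body.always (φ : Body) : Body := .neg (.untl .verum (.neg φ))

/-- The conjunction of a finite family of formulas. -/
noncomputable def Body.conj {ι : Type} [Fintype ι] (f : ι → Body) : Body :=
  (Finset.univ.toList.map f).foldr Body.and Body.verum

variable {A : Set ℕ} {P : Assignment A} {ι : Type} [Fintype ι]

@[simp] theorem Body.sat_neg (φ : Body) : (Body.neg φ).Sat P ↔ ¬ φ.Sat P := by
  simp only [Body.Sat]

@[simp] theorem Body.sat_or (φ ψ : Body) : (Body.or φ ψ).Sat P ↔ φ.Sat P ∨ ψ.Sat P := by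
  simp only [Body.Sat]

@[simp] theorem Body.sat_next (φ : Body) : (Body.next φ).Sat P ↔ φ.Sat (P.suffix 1) := by
  simp only [Body.Sat]

@[simp] theorem Body.sat_verum : Body.verum.Sat P := by
  simp only [Body.verum, Body.sat_or, Body.sat_neg, em]

@[simp] theorem Body.sat_and (φ ψ : Body) : (φ.and ψ).Sat P ↔ φ.Sat P ∧ ψ.Sat P := by
  simp only [Body.and, Body.sat_neg, Body.sat_or, not_or, not_not]

@[simp] theorem Body.sat_imp (φ ψ : Body) : (φ.imp ψ).Sat P ↔ (φ.Sat P → ψ.Sat P) := by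
  simp only [Body.imp, Body.sat_neg, Body.sat_or, imp_iff_not_or]

@[simp] theorem Body.sat_iff (φ ψ : Body) : (φ.iff ψ).Sat P ↔ (φ.Sat P ↔ ψ.Sat P) := by
  simp only [Body.iff, Body.sat_and, Body.sat_imp, iff_iff_implies_and_implies]

@[simp] theorem Body.sat_always (φ : Body) :
    φ.always.Sat P ↔ ∀ i, φ.Sat (P.suffix i) := by
  simp [Body.always, Body.Sat]

@[simp] theorem Body.sat_conj (f : ι → Body) : (Body.conj f).Sat P ↔ ∀ i, (f i).Sat P := by
  have hfoldr (l : List Body) : (l.foldr Body.and Body.verum).Sat P ↔ ∀ φ ∈ l, φ.Sat P := by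
    induction l with
    | nil => simp
    | cons φ l ih => simp [ih]
  simp [Body.conj, hfoldr]

@[simp] theorem Assignment.suffix_zero : P.suffix 0 = P := by
  funext x
  simp [Assignment.suffix]

@[simp] theorem Assignment.suffix_suffix (i j : ℕ) :
    (P.suffix i).suffix j = P.suffix (i + j) := by
  funext x
  simp [Assignment.suffix, Function.comp_def, add_assoc, add_comm i j]

theorem Assignment.suffix_apply {x : ℕ} {t : Trace (Letter A)} (h : P x = some t) (i : ℕ) :
    P.suffix i x = some fun n => t (n + i) := by
  simp [Assignment.suffix, h]

/-- The proposition `a` belongs to the alphabet and holds at position `i` of `t`. -/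
def Holds (t : Trace (Letter A)) (i a : ℕ) : Prop := ∃ h : a ∈ A, (⟨a, h⟩ : A) ∈ t i

theorem Body.sat_atom_suffix {x : ℕ} {t : Trace (Letter A)} (h : P x = some t) (a i : ℕ) :
    (Body.atom a x).Sat (P.suffix i) ↔ Holds t i a := by
  simp [Body.Sat, Assignment.suffix_apply h, Holds]

theorem Body.sat_atom {x : ℕ} {t : Trace (Letter A)} (h : P x = some t) (a : ℕ) :
    (Body.atom a x).Sat P ↔ Holds t 0 a := by
  simpa using Body.sat_atom_suffix h a 0

variable {s : Set ℕ} {φ ψ : Body}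

theorem Body.vars_verum_subset (hs : 0 ∈ s) : Body.verum.vars ⊆ s := by
  simpa [Body.verum, Body.vars] using hs

theorem Body.vars_and_subset (hφ : φ.vars ⊆ s) (hψ : ψ.vars ⊆ s) : (φ.and ψ).vars ⊆ s :=
  Set.union_subset hφ hψ

theorem Body.vars_imp_subset (hφ : φ.vars ⊆ s) (hψ : ψ.vars ⊆ s) : (φ.imp ψ).vars ⊆ s :=
  Set.union_subset hφ hψ

theorem Body.vars_iff_subset (hφ : φ.vars ⊆ s) (hψ : ψ.vars ⊆ s) : (φ.iff ψ).vars ⊆ s :=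
  vars_and_subset (vars_imp_subset hφ hψ) (vars_imp_subset hψ hφ)

theorem Body.vars_always_subset (hs : 0 ∈ s) (hφ : φ.vars ⊆ s) : φ.always.vars ⊆ s :=
  Set.union_subset (vars_verum_subset hs) hφ

theorem Body.vars_conj_subset (hs : 0 ∈ s) {f : ι → Body} (hf : ∀ i, (f i).vars ⊆ s) :
    (Body.conj f).vars ⊆ s := by
  have hfoldr (l : List ι) : ((l.map f).foldr Body.and Body.verum).vars ⊆ s := by
    induction l with
    | nil => exact vars_verum_subset hs
    | cons i l ih => exact vars_and_subset (hf i) ih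
  exact hfoldr _

end Connectives

section Restriction

variable {A B : Set ℕ}

/-- The trace over the smaller set `A` of atomic propositions obtained from a trace over `B` by
forgetting the propositions outside `A`. -/
def restrict (h : A ⊆ B) (t : Trace (Letter B)) : Trace (Letter A) :=
  fun i => Set.inclusion h ⁻¹' t i

theorem Body.sat_restrict (h : A ⊆ B) (φ : Body) (hφ : φ.props ⊆ A) (P : Assignment B) :
    φ.Sat (fun x => (P x).map (restrict h)) ↔ φ.Sat P := by
  have hsuffix (P : Assignment B) (i : ℕ) :
      Assignment.suffix (fun x => (P x).map (restrict h)) i =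
        fun x => (P.suffix i x).map (restrict h) := by
    funext x
    simp only [Assignment.suffix, Option.map_map]
    rfl
  induction φ generalizing P with
  | atom a x =>
    have haA : a ∈ A := hφ rfl
    rcases hx : P x with _ | t <;> simp [Body.Sat, hx, haA, h haA, restrict]
  | neg φ ih => simp only [Body.sat_neg, ih hφ]
  | or φ ψ ihφ ihψ =>
    obtain ⟨h₁, h₂⟩ := Set.union_subset_iff.1 hφ
    simp only [Body.sat_or, ihφ h₁, ihψ h₂]
  | next φ ih => simp only [Body.sat_next, hsuffix, ih hφ]
  | untl φ ψ ihφ ihψ =>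
    obtain ⟨h₁, h₂⟩ := Set.union_subset_iff.1 hφ
    simp only [Body.Sat, hsuffix, ihφ h₁, ihψ h₂]

theorem HyperLTL.sat_restrict (h : A ⊆ B) (T : Set (Trace (Letter B))) (φ : HyperLTL)
    (hφ : φ.props ⊆ A) (P : Assignment B) :
    φ.Sat (restrict h '' T) (fun x => (P x).map (restrict h)) ↔ φ.Sat T P := by
  have hupdate (P : Assignment B) (x : ℕ) (t : Trace (Letter B)) :
      Function.update (fun x => (P x).map (restrict h)) x (some (restrict h t)) =
        fun y => (Function.update P x (some t) y).map (restrict h) := by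
    funext y
    obtain rfl | hy := eq_or_ne y x <;> simp [*]
  induction φ generalizing P with
  | body φ => exact Body.sat_restrict h φ hφ P
  | all x ψ ih => simp only [HyperLTL.Sat, Set.forall_mem_image, hupdate, ih hφ]
  | ex x ψ ih => simp only [HyperLTL.Sat, Set.exists_mem_image, hupdate, ih hφ]

end Restriction

section Tracks

variable {A : Set ℕ} {Γ : Type} {p r : Γ → ℕ} {t t' : Trace (Letter A)}

/-- At each position `i` of `t`, among the propositions `p a` exactly `p (f i)` holds: the
sequence `f` is written on `t` by means of the propositions `p`. -/
def IsTrack (t : Trace (Letter A)) (p : Γ → ℕ) (f : ℕ → Γ) : Prop :=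
  ∀ i a, Holds t i (p a) ↔ a = f i

theorem isTrack_iff_zero_succ {f : ℕ → Γ} : IsTrack t p f ↔
    (∀ a, Holds t 0 (p a) ↔ a = f 0) ∧ IsTrack (fun i => t (i + 1)) p (fun i => f (i + 1)) :=
  Nat.and_forall_add_one.symm

variable [Fintype Γ]

open Classical in
/-- Among the propositions `p b`, exactly `p a` holds now on the trace `x`. -/
noncomputable def Body.only (p : Γ → ℕ) (a : Γ) (x : ℕ) : Body :=
  .conj fun b => if b = a then .atom (p b) x else .neg (.atom (p b) x)

/-- The propositions `p a` at the `m`-th next position of the trace `x` agree with the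
propositions `r a` at the `n`-th next position of the trace `y`. -/
noncomputable def Body.agree (p : Γ → ℕ) (x m : ℕ) (r : Γ → ℕ) (y n : ℕ) : Body :=
  .conj fun a => .iff (Body.next^[m] (.atom (p a) x)) (Body.next^[n] (.atom (r a) y))

/-- The list `l`, continued by the default symbol, is written on the trace `x` by means of the
propositions `p`. -/
noncomputable def Body.track [Inhabited Γ] (p : Γ → ℕ) (x : ℕ) : List Γ → Body
  | [] => .always (.only p default x)
  | a :: l => .and (.only p a x) (.next (track p x l))

/-- The track `p` loses its first symbol, which is put in front of the track `r`, in passing from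
the trace `x` to the trace `y`. -/
noncomputable def Body.transfer (p r : Γ → ℕ) (x y : ℕ) : Body :=
  .and (.always (.agree p y 0 p x 1)) (.and (.agree r y 0 p x 0) (.always (.agree r y 1 r x 0)))

/-- The first symbol of the track `p` becomes `a` and the track `r` does not change, in passing
from the trace `x` to the trace `y`. -/
noncomputable def Body.overwrite (p r : Γ → ℕ) (a : Γ) (x y : ℕ) : Body :=
  .and (.only p a y) (.and (.always (.agree p y 1 p x 1)) (.always (.agree r y 0 r x 0)))

variable {P : Assignment A} {x y : ℕ}

theorem Body.sat_iterate_next (φ : Body) (n : ℕ) :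
    (Body.next^[n] φ).Sat P ↔ φ.Sat (P.suffix n) := by
  induction n generalizing P with
  | zero => simp
  | succ n ih => rw [Function.iterate_succ_apply', sat_next, ih, Assignment.suffix_suffix, add_comm]

theorem Body.sat_only_suffix (hx : P x = some t) (a : Γ) (i : ℕ) :
    (Body.only p a x).Sat (P.suffix i) ↔ ∀ b, Holds t i (p b) ↔ b = a := by
  refine (Body.sat_conj _).trans (forall_congr' fun b => ?_)
  split_ifs with hb <;> simp [sat_atom_suffix hx, hb]

theorem Body.sat_only (hx : P x = some t) (a : Γ) :
    (Body.only p a x).Sat P ↔ ∀ b, Holds t 0 (p b) ↔ b = a := by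
  simpa using sat_only_suffix hx a 0

theorem Body.sat_agree_suffix (hx : P x = some t) (hy : P y = some t') (m n i : ℕ) :
    (Body.agree p x m r y n).Sat (P.suffix i) ↔
      ∀ a, Holds t (i + m) (p a) ↔ Holds t' (i + n) (r a) := by
  simp [agree, sat_iterate_next, sat_atom_suffix hx, sat_atom_suffix hy]

theorem Body.sat_agree (hx : P x = some t) (hy : P y = some t') (m n : ℕ) :
    (Body.agree p x m r y n).Sat P ↔ ∀ a, Holds t m (p a) ↔ Holds t' n (r a) := by
  simpa using sat_agree_suffix hx hy m n 0

theorem Body.sat_track [Inhabited Γ] (hx : P x = some t) (l : List Γ) :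
    (Body.track p x l).Sat P ↔ IsTrack t p l.getI := by
  induction l generalizing P t with
  | nil => simp [track, sat_only_suffix hx, IsTrack]
  | cons a l ih =>
    rw [track, sat_and, sat_only hx, sat_next, ih (Assignment.suffix_apply hx 1),
      isTrack_iff_zero_succ (t := t)]
    rfl

theorem Body.sat_transfer (hx : P x = some t) (hy : P y = some t') {f g f' g' : ℕ → Γ}
    (hf : IsTrack t p f) (hg : IsTrack t r g) (hf' : ∀ i, f' i = f (i + 1)) (hg'0 : g' 0 = f 0)
    (hg' : ∀ i, g' (i + 1) = g i) :
    (Body.transfer p r x y).Sat P ↔ IsTrack t' p f' ∧ IsTrack t' r g' := by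
  rw [isTrack_iff_zero_succ (p := r)]
  simp only [transfer, sat_and, sat_always, sat_agree hy hx, sat_agree_suffix hy hx, hf _ _,
    hg _ _, IsTrack, hf', hg'0, hg', add_zero]
  rfl

theorem Body.sat_overwrite (hx : P x = some t) (hy : P y = some t') {a : Γ} {f g f' : ℕ → Γ}
    (hf : IsTrack t p f) (hg : IsTrack t r g) (hf'0 : f' 0 = a)
    (hf' : ∀ i, f' (i + 1) = f (i + 1)) :
    (Body.overwrite p r a x y).Sat P ↔ IsTrack t' p f' ∧ IsTrack t' r g := by
  rw [isTrack_iff_zero_succ, and_assoc]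
  simp only [overwrite, sat_and, sat_always, sat_only hy, sat_agree_suffix hy hx, hf _ _,
    hg _ _, IsTrack, hf', hf'0, add_zero]
  rfl

variable {s : Set ℕ}

theorem Body.vars_iterate_next (φ : Body) (n : ℕ) : (Body.next^[n] φ).vars = φ.vars := by
  induction n with
  | zero => rfl
  | succ n ih => rw [Function.iterate_succ_apply', ← ih, vars]

theorem Body.vars_only_subset (hs : 0 ∈ s) (hx : x ∈ s) (p : Γ → ℕ) (a : Γ) :
    (Body.only p a x).vars ⊆ s :=
  vars_conj_subset hs fun b => by split_ifs <;> simpa [vars] using hx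

theorem Body.vars_agree_subset (hs : 0 ∈ s) (hx : x ∈ s) (hy : y ∈ s) (p r : Γ → ℕ) (m n : ℕ) :
    (Body.agree p x m r y n).vars ⊆ s :=
  vars_conj_subset hs fun a => vars_iff_subset
    (by simpa [vars_iterate_next, vars] using hx) (by simpa [vars_iterate_next, vars] using hy)

theorem Body.vars_track_subset [Inhabited Γ] (hs : 0 ∈ s) (hx : x ∈ s) (p : Γ → ℕ)
    (l : List Γ) : (Body.track p x l).vars ⊆ s := by
  induction l with
  | nil => exact vars_always_subset hs (vars_only_subset hs hx p _)
  | cons a l ih => exact vars_and_subset (vars_only_subset hs hx p a) ih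

theorem Body.vars_transfer_subset (hs : 0 ∈ s) (hx : x ∈ s) (hy : y ∈ s) (p r : Γ → ℕ) :
    (Body.transfer p r x y).vars ⊆ s :=
  vars_and_subset (vars_always_subset hs (vars_agree_subset hs hy hx ..))
    (vars_and_subset (vars_agree_subset hs hy hx ..)
      (vars_always_subset hs (vars_agree_subset hs hy hx ..)))

theorem Body.vars_overwrite_subset (hs : 0 ∈ s) (hx : x ∈ s) (hy : y ∈ s) (p r : Γ → ℕ) (a : Γ) :
    (Body.overwrite p r a x y).vars ⊆ s :=
  vars_and_subset (vars_only_subset hs hy p a)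
    (vars_and_subset (vars_always_subset hs (vars_agree_subset hs hy hx ..))
      (vars_always_subset hs (vars_agree_subset hs hy hx ..)))

end Tracks

section Instructions

variable {A : Set ℕ} {Γ : Type} [Encodable Γ]

/-- The proposition stating, at position `i`, that the `i`-th cell of the right half of the tape
contains `a`. -/
def rightProp (a : Γ) : ℕ := 3 * Encodable.encode a + 1

/-- The proposition stating, at position `i`, that the `i`-th cell of the left half of the tape
contains `a`. -/
def leftProp (a : Γ) : ℕ := 3 * Encodable.encode a + 2

/-- The tape described by the trace `y` results from the one described by the trace `x` by
executing a single instruction. -/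
noncomputable def Body.instr [Fintype Γ] (x y : ℕ) : TM0.Stmt Γ → Body
  | .move .right => .transfer (Γ := Γ) rightProp leftProp x y
  | .move .left => .transfer (Γ := Γ) leftProp rightProp x y
  | .write a => .overwrite rightProp leftProp a x y

theorem Body.vars_instr_subset [Fintype Γ] {s : Set ℕ} {x y : ℕ} (hs : 0 ∈ s) (hx : x ∈ s)
    (hy : y ∈ s) : ∀ i : TM0.Stmt Γ, (Body.instr x y i).vars ⊆ s
  | .move .right => vars_transfer_subset hs hx hy ..
  | .move .left => vars_transfer_subset hs hx hy ..
  | .write _ => vars_overwrite_subset hs hx hy ..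

variable [Inhabited Γ]

/-- The cells of a tape from the head on rightwards. -/
def rightHalf (T : Tape Γ) (i : ℕ) : Γ := T.nth i

/-- The cells of a tape to the left of the head, read leftwards. -/
def leftHalf (T : Tape Γ) (i : ℕ) : Γ := T.nth (-(i + 1))

/-- The trace `t` describes the tape `T`. -/
def EncodesTape (t : Trace (Letter A)) (T : Tape Γ) : Prop :=
  IsTrack t rightProp (rightHalf T) ∧ IsTrack t leftProp (leftHalf T)

/-- The effect of a single instruction on the tape. -/
def applyInstr (T : Tape Γ) : TM0.Stmt Γ → Tape Γ
  | .move d => T.move d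
  | .write a => T.write a

theorem Body.sat_instr [Fintype Γ] {P : Assignment A} {x y : ℕ} {t t' : Trace (Letter A)}
    (hx : P x = some t) (hy : P y = some t') {T : Tape Γ} (hT : EncodesTape t T)
    (i : TM0.Stmt Γ) : (Body.instr x y i).Sat P ↔ EncodesTape t' (applyInstr T i) := by
  obtain ⟨hright, hleft⟩ := hT
  rcases i with (_ | _) | a
  · refine (sat_transfer hx hy hleft hright ?_ ?_ ?_).trans and_comm
    · simp [applyInstr, leftHalf, add_comm, sub_eq_add_neg]
    · simpa [applyInstr, rightHalf, leftHalf] using T.move_left_nth 0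
    · simp [applyInstr, rightHalf]
  · refine sat_transfer hx hy hright hleft ?_ ?_ ?_ <;> simp [applyInstr, rightHalf, leftHalf]
  · have hleft' : leftHalf (T.write a) = leftHalf T := funext fun i => by
      rw [leftHalf, leftHalf, Tape.write_nth, if_neg (by omega)]
    rw [EncodesTape, applyInstr, hleft']
    refine sat_overwrite hx hy hright hleft ?_ fun i => ?_
    · exact T.write_nth a (i := 0)
    · rw [rightHalf, rightHalf, Tape.write_nth, if_neg (by omega)]

end Instructions

section Machine

variable {A : Set ℕ} {Γ Λ : Type} [Inhabited Γ]

/-- The proposition stating, at position `0`, that the current state is `q`. The residue modulo `3`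
distinguishes it from the propositions `rightProp` and `leftProp`. -/
def stateProp [Encodable Λ] (q : Λ) : ℕ := 3 * Encodable.encode q

variable [Encodable Γ] [Encodable Λ]

/-- The trace `t` describes the configuration `c`. -/
def EncodesCfg (t : Trace (Letter A)) (c : TM0.Cfg Γ Λ) : Prop :=
  (∀ q : Λ, Holds t 0 (stateProp q) ↔ q = c.q) ∧ EncodesTape t c.Tape

/-- The trace over the full set of propositions that describes the configuration `c`. -/
def cfgTrace (c : TM0.Cfg Γ Λ) : Trace (Letter Set.univ) := fun i =>
  {p | p.1 = stateProp c.q ∨ p.1 = rightProp (rightHalf c.Tape i) ∨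
    p.1 = leftProp (leftHalf c.Tape i)}

theorem encodesCfg_cfgTrace (c : TM0.Cfg Γ Λ) : EncodesCfg (cfgTrace c) c := by
  refine ⟨fun q => ?_, fun i a => ?_, fun i a => ?_⟩ <;>
  · rw [← Encodable.encode_inj]
    simp only [Holds, cfgTrace, stateProp, rightProp, leftProp, Set.mem_ofPred_eq, Set.mem_univ,
      exists_true_left]
    omega

variable [Inhabited Λ] [Fintype Γ] [Fintype Λ]

/-- The machine performs the given entry of its transition table in passing from the trace `x` to
the trace `y`; the entry `none`, for halting, cannot be performed. -/
noncomputable def Body.action (x y : ℕ) : Option (Λ × TM0.Stmt Γ) → Body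
  | none => .neg .verum
  | some (q, s) => .and (.only stateProp q y) (.instr x y s)

/-- The configuration described by the trace `y` is the successor of the one described by the
trace `x`. -/
noncomputable def Body.step (M : TM0.Machine Γ Λ) (x y : ℕ) : Body :=
  .conj fun k : Λ × Γ => .imp (.and (.atom (stateProp k.1) x) (.atom (rightProp k.2) x))
    (Body.action x y (M k.1 k.2))

/-- The trace `x` describes the initial configuration on the input `l`. -/
noncomputable def Body.start (Λ : Type) [Inhabited Λ] [Encodable Λ] [Fintype Λ] (l : List Γ)
    (x : ℕ) : Body :=
  .and (.only stateProp (default : Λ) x)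
    (.and (.track rightProp x l) (.track (Γ := Γ) leftProp x []))

/-- The sentence stating that there is a trace describing the initial configuration on the input
`l`, and that the described configurations are closed under taking successors. -/
noncomputable def runSentence (M : TM0.Machine Γ Λ) (l : List Γ) : HyperLTL :=
  .ex 0 (.all 1 (.ex 2 (.body (.and (Body.start Λ l 0) (Body.step M 1 2)))))

variable {P : Assignment A} {x y : ℕ} {t t' : Trace (Letter A)}

theorem Body.sat_start (hx : P x = some t) (l : List Γ) :
    (Body.start Λ l x).Sat P ↔ EncodesCfg t (TM0.init l : TM0.Cfg Γ Λ) := by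
  have hright : rightHalf (Tape.mk₁ l) = l.getI := by
    funext i
    simp [rightHalf, Tape.mk₁, Tape.mk₂]
  have hleft : leftHalf (Tape.mk₁ l) = ([] : List Γ).getI := by
    funext i
    change (Tape.mk₁ l).left.nth i = _
    simp [Tape.mk₁, Tape.mk₂]
  simp only [Body.start, Body.sat_and, Body.sat_only hx, Body.sat_track hx, EncodesCfg,
    EncodesTape, TM0.init, hright, hleft]

theorem Body.sat_step (M : TM0.Machine Γ Λ) (hx : P x = some t) (hy : P y = some t')
    {c : TM0.Cfg Γ Λ} (hc : EncodesCfg t c) :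
    (Body.step M x y).Sat P ↔ ∃ c', TM0.step M c = some c' ∧ EncodesCfg t' c' := by
  obtain ⟨q, T⟩ := c
  obtain ⟨hstate, htape⟩ := hc
  have hentry : (Body.step M x y).Sat P ↔ (Body.action x y (M q T.head)).Sat P := by
    simp [Body.step, Body.sat_atom hx, hstate, htape.1 0, rightHalf]
  rw [hentry, TM0.step]
  rcases M q T.head with _ | ⟨q', s⟩
  · simp [Body.action]
  · simp only [Body.action, Body.sat_and, Body.sat_only hy, Body.sat_instr hx hy htape,
      Option.map_some, Option.some.injEq, exists_eq_left', EncodesCfg]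
    rfl

theorem isSentence_runSentence (M : TM0.Machine Γ Λ) (l : List Γ) :
    (runSentence M l).IsSentence := by
  have hinit : (Body.start Λ l 0).vars ⊆ {0, 1, 2} :=
    Body.vars_and_subset (Body.vars_only_subset (by simp) (by simp) ..) <|
      Body.vars_and_subset (Body.vars_track_subset (by simp) (by simp) ..)
        (Body.vars_track_subset (by simp) (by simp) ..)
  have haction : ∀ o, (Body.action (Γ := Γ) (Λ := Λ) 1 2 o).vars ⊆ {0, 1, 2}
    | none => Body.vars_verum_subset (by simp)
    | some _ => Body.vars_and_subset (Body.vars_only_subset (by simp) (by simp) ..)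
        (Body.vars_instr_subset (by simp) (by simp) (by simp) _)
  have hstep : (Body.step M 1 2).vars ⊆ {0, 1, 2} :=
    Body.vars_conj_subset (by simp) fun k => Body.vars_imp_subset
      (Body.vars_and_subset (by simp [Body.vars]) (by simp [Body.vars])) (haction _)
  have hvars := Body.vars_and_subset hinit hstep
  rw [HyperLTL.IsSentence, runSentence, Set.eq_empty_iff_forall_notMem]
  simp only [HyperLTL.freeVars]
  rintro i ⟨⟨⟨hi, hi2⟩, hi1⟩, hi0⟩
  rcases hvars hi with h | h | h <;> contradiction

theorem lang_runSentence_eq_empty_of_dom {M : TM0.Machine Γ Λ} {l : List Γ}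
    (h : (TM0.eval M l).Dom) : (runSentence M l).lang A = ∅ := by
  refine Set.eq_empty_of_forall_notMem fun T ⟨z, hz, hT⟩ => ?_
  have hinit : EncodesCfg z (TM0.init l : TM0.Cfg Γ Λ) := by
    obtain ⟨t', -, hsat⟩ := hT z hz
    exact (Body.sat_start (by simp) l).1 ((Body.sat_and _ _).1 hsat).1
  have hstep {t} (ht : t ∈ T) {c : TM0.Cfg Γ Λ} (hc : EncodesCfg t c) :
      ∃ t' ∈ T, ∃ c', TM0.step M c = some c' ∧ EncodesCfg t' c' := by
    obtain ⟨t', ht', hsat⟩ := hT t ht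
    exact ⟨t', ht', (Body.sat_step M (by simp) (by simp) hc).1 ((Body.sat_and _ _).1 hsat).2⟩
  have hreach {c} (hc : StateTransition.Reaches (TM0.step M) (TM0.init l) c) :
      ∃ t ∈ T, EncodesCfg t c := by
    induction hc with
    | refl => exact ⟨z, hz, hinit⟩
    | tail _ hc' ih =>
      obtain ⟨t, ht, hc⟩ := ih
      obtain ⟨t', ht', c', hstepc, henc⟩ := hstep ht hc
      exact ⟨t', ht', Option.mem_unique hstepc hc' ▸ henc⟩
  obtain ⟨c, hc⟩ := Part.dom_iff_mem.1 h
  obtain ⟨c, hc, -⟩ := (Part.mem_map_iff _).1 hc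
  obtain ⟨hc, hhalt⟩ := StateTransition.mem_eval.1 hc
  obtain ⟨t, ht, htc⟩ := hreach hc
  obtain ⟨t', -, c', hc', -⟩ := hstep ht htc
  simp [hhalt] at hc'

theorem sat_runSentence_of_not_dom {M : TM0.Machine Γ Λ} {l : List Γ}
    (h : ¬ (TM0.eval M l).Dom) :
    (runSentence M l).Sat
      (cfgTrace '' {c | StateTransition.Reaches (TM0.step M) (TM0.init l) c}) fun _ => none := by
  refine ⟨_, ⟨_, .refl, rfl⟩, ?_⟩
  rintro _ ⟨c, hc, rfl⟩
  obtain ⟨c', hc'⟩ : ∃ c', TM0.step M c = some c' := by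
    refine Option.ne_none_iff_exists'.1 fun hhalt => h ?_
    exact Part.dom_iff_mem.2 ⟨_, Part.mem_map _ (StateTransition.mem_eval.2 ⟨hc, hhalt⟩)⟩
  refine ⟨_, ⟨c', hc.tail hc', rfl⟩, (Body.sat_and _ _).2 ⟨?_, ?_⟩⟩
  · exact (Body.sat_start (by simp) l).2 (encodesCfg_cfgTrace _)
  · exact (Body.sat_step M (by simp) (by simp) (encodesCfg_cfgTrace c)).2
      ⟨c', hc', encodesCfg_cfgTrace c'⟩

theorem dom_of_isWeakSafety_lang_runSentence {M : TM0.Machine Γ Λ} {l : List Γ}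
    (hA : (runSentence M l).props ⊆ A) (hS : IsWeakSafety ((runSentence M l).lang A)) :
    (TM0.eval M l).Dom := by
  by_contra h
  have hsat := (HyperLTL.sat_restrict (Set.subset_univ A) _ _ hA _).2 (sat_runSentence_of_not_dom h)
  exact Set.eq_empty_iff_forall_notMem.1 (eq_empty_of_isWeakSafety_lang_ex hS) _ hsat

end Machine

section Computability

instance : Denumerable Body :=
  Denumerable.mk' ⟨Body.code, Body.ofCode, Body.ofCode_code, Body.code_ofCode⟩

theorem Body.primrec_neg : Primrec Body.neg :=
  Primrec.encode_iff.1 <|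
    Primrec.nat_add.comp (Primrec.nat_mul.comp (.const 5) .encode) (.const 1)

theorem Body.primrec_or : Primrec₂ Body.or :=
  Primrec.encode_iff.1 <| Primrec.nat_add.comp (Primrec.nat_mul.comp (.const 5)
    (Primrec₂.natPair.comp (Primrec.encode.comp .fst) (Primrec.encode.comp .snd))) (.const 2)

theorem Body.primrec_next : Primrec Body.next :=
  Primrec.encode_iff.1 <|
    Primrec.nat_add.comp (Primrec.nat_mul.comp (.const 5) .encode) (.const 3)

theorem Body.primrec_and : Primrec₂ Body.and :=
  primrec_neg.comp (primrec_or.comp (primrec_neg.comp .fst) (primrec_neg.comp .snd))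

theorem HyperLTL.primrec_body : Primrec HyperLTL.body :=
  Primrec.encode_iff.1 (Primrec.nat_mul.comp (.const 3) .encode)

theorem HyperLTL.primrec_all (x : ℕ) : Primrec (HyperLTL.all x) :=
  Primrec.encode_iff.1 <| Primrec.nat_add.comp
    (Primrec.nat_mul.comp (.const 3) (Primrec₂.natPair.comp (.const x) .encode)) (.const 1)

theorem HyperLTL.primrec_ex (x : ℕ) : Primrec (HyperLTL.ex x) :=
  Primrec.encode_iff.1 <| Primrec.nat_add.comp
    (Primrec.nat_mul.comp (.const 3) (Primrec₂.natPair.comp (.const x) .encode)) (.const 2)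

variable {Γ Λ : Type} [Inhabited Γ] [Fintype Γ]

theorem Body.track_replicate (p : Γ → ℕ) (x : ℕ) (b : Γ) (n : ℕ) :
    Body.track p x (.replicate n b) =
      (fun φ => .and (.only p b x) (.next φ))^[n] (.track p x []) := by
  induction n with
  | zero => rfl
  | succ n ih => rw [List.replicate_succ, Function.iterate_succ_apply', ← ih, track]

theorem Body.primrec_track (p : Γ → ℕ) (x : ℕ) (a b : Γ) :
    Primrec fun n => Body.track p x (a :: .replicate n b) := by
  simp only [track, track_replicate]
  exact primrec_and.comp (.const _) <| primrec_next.comp <| .nat_iterate .id (.const _)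
    (primrec_and.comp (.const _) (primrec_next.comp .snd))

theorem primrec_runSentence [Inhabited Λ] [Fintype Λ] [Encodable Γ] [Encodable Λ]
    (M : TM0.Machine Γ Λ) (a b : Γ) :
    Primrec fun n => runSentence M (a :: .replicate n b) :=
  (HyperLTL.primrec_ex 0).comp <| (HyperLTL.primrec_all 1).comp <| (HyperLTL.primrec_ex 2).comp <|
    HyperLTL.primrec_body.comp <| Body.primrec_and.comp
      (Body.primrec_and.comp (.const _) (Body.primrec_and.comp (Body.primrec_track ..) (.const _)))
      (.const _)

end Computability

section UnaryMachine

theorem exists_partrec_comp_eq {f : ℕ →. ℕ} (hf : Partrec f) {h : ℕ → ℕ}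
    (hh : Computable h) (hinj : Function.Injective h) :
    ∃ g : ℕ →. ℕ, Partrec g ∧ ∀ n, g (h n) = f n := by
  have hinv : Partrec fun m => Nat.rfind fun n => Part.some (decide (h n = m)) :=
    Partrec.rfind (Computable₂.partrec₂ <| (Primrec.beq.to_comp).comp₂
        (hh.comp Computable.snd).to₂ Computable.fst.to₂ |>.of_eq fun p => by
          simp [BEq.beq])
  refine ⟨_, hinv.bind (hf.comp Computable.snd).to₂, fun n => ?_⟩
  have hn : n ∈ Nat.rfind fun k => Part.some (decide (h k = h n)) :=
    Nat.mem_rfind.2 ⟨by simp, fun {k} hk => by simpa [hinj.eq_iff] using hk.ne⟩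
  rw [Part.eq_some_iff.2 hn, Part.bind_some]

theorem exists_toPartrecCode {f : ℕ →. ℕ} (hf : Partrec f) :
    ∃ c : ToPartrec.Code, ∀ n, (c.eval [n]).Dom ↔ (f n).Dom := by
  obtain ⟨c, hc⟩ := ToPartrec.Code.exists_code (Nat.Partrec'.part_iff₁.2 hf)
  refine ⟨c, fun n => ?_⟩
  have := hc (n ::ᵥ .nil)
  simp only [List.Vector.head_cons] at this
  change c.eval [n] = _ at this
  rw [this]; rfl

theorem exists_tm0_restrict {Γ Λ : Type} [Inhabited Γ] [Inhabited Λ] (M : TM0.Machine Γ Λ)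
    {S : Set Λ} (hS : TM0.Supports M S) :
    ∃ (_ : Inhabited S) (M' : TM0.Machine Γ S),
      ∀ l, (TM0.eval M' l).Dom ↔ (TM0.eval M l).Dom := by
  classical
  let _ : Inhabited S := ⟨⟨default, hS.1⟩⟩
  let idΓ : PointedMap Γ Γ := ⟨id, rfl⟩
  let toS : PointedMap Λ S := ⟨fun q => if h : q ∈ S then ⟨q, h⟩ else default, dif_pos hS.1⟩
  have toS_val (q) (hq : q ∈ S) : (toS q : Λ) = q := congrArg Subtype.val (dif_pos hq)
  refine ⟨‹_›, M.map idΓ idΓ toS Subtype.val, fun l => ?_⟩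
  refine StateTransition.tr_eval_dom
    (M.map_respects idΓ idΓ toS Subtype.val hS (fun _ => rfl) toS_val) ⟨hS.1, ?_⟩
  rw [TM0.map_init]
  exact congrArg TM0.init (List.map_id l)

theorem exists_finite_tm0_of_tm2 {K : Type} [DecidableEq K] [Finite K] {Γ : K → Type}
    {Λ σ : Type} [Inhabited Λ] [Inhabited σ] [Finite σ]
    (M : Λ → TM2.Stmt Γ Λ σ) {S : Finset Λ} (hS : TM2.Supports M S) (k : K) :
    ∃ (Λ' : Type) (_ : Inhabited Λ') (_ : Finite Λ') (M' : TM0.Machine (TM2to1.Γ' K Γ) Λ'),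
      ∀ l, (TM0.eval M' (TM2to1.trInit k l)).Dom ↔ (TM2.eval M k l).Dom := by
  have := Fintype.ofFinite K
  have := Fintype.ofFinite σ
  obtain ⟨_, M', hM'⟩ := exists_tm0_restrict _ (TM1to0.tr_supports _ (TM2to1.tr_supports M hS))
  exact ⟨_, ‹_›, inferInstance, M', fun l => by
    rw [hM', TM1to0.tr_eval, TM2to1.tr_eval_dom]⟩

theorem trNat_two_mul_add_one (n : ℕ) :
    PartrecToTM2.trNat (2 * n + 1) = .bit1 :: PartrecToTM2.trNat n := by
  have hcast : ((2 * n + 1 : ℕ) : Num) = (n : Num).bit1 := by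
    rw [← Num.bit1_of_bit1]
    push_cast
    rw [two_mul]
  rw [PartrecToTM2.trNat, PartrecToTM2.trNat, hcast]
  cases (n : Num) <;> rfl

theorem trNat_iterate (n : ℕ) :
    PartrecToTM2.trNat ((2 * · + 1)^[n] 0) = List.replicate n .bit1 := by
  induction n with
  | zero => exact PartrecToTM2.trNat_zero
  | succ n ih =>
    rw [Function.iterate_succ_apply', trNat_two_mul_add_one, ih, List.replicate_succ]

theorem exists_trInit_replicate {K : Type} [DecidableEq K] {Γ : K → Type} (k : K) (s t : Γ k) :
    ∃ a b : TM2to1.Γ' K Γ,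
      ∀ n, TM2to1.trInit k (List.replicate n t ++ [s]) = a :: List.replicate n b :=
  ⟨(true, Function.update (fun _ => none) k (some s)),
    (false, Function.update (fun _ => none) k (some t)), fun n => by
      rw [TM2to1.trInit, List.reverse_append, List.reverse_replicate]
      exact congrArg (List.cons _) List.map_replicate⟩

theorem tm2_eval_dom_iff (c : ToPartrec.Code) (v : List ℕ) :
    (@TM2.eval _ _ _ _ ⟨PartrecToTM2.trNormal c .halt⟩ _ _ PartrecToTM2.tr .main
      (PartrecToTM2.trList v)).Dom ↔ (c.eval v).Dom := by
  let _ : Inhabited PartrecToTM2.Λ' := ⟨PartrecToTM2.trNormal c .halt⟩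
  have hinit : TM2.init PartrecToTM2.K'.main (PartrecToTM2.trList v) =
      PartrecToTM2.init c v := by
    rw [TM2.init, PartrecToTM2.init]
    congr
    funext k
    cases k <;> rfl
  change (StateTransition.eval (TM2.step PartrecToTM2.tr) (TM2.init _ _)).Dom ↔ _
  rw [hinit, PartrecToTM2.tr_eval]
  rfl

theorem exists_tm0_unary {f : ℕ →. ℕ} (hf : Partrec f) :
    ∃ (Γ Λ : Type) (_ : Inhabited Γ) (_ : Inhabited Λ) (_ : Finite Γ) (_ : Finite Λ)
      (M : TM0.Machine Γ Λ) (a b : Γ),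
      ∀ n, (TM0.eval M (a :: List.replicate n b)).Dom ↔ (f n).Dom := by
  -- The `n`-th iterate of `2 * x + 1` at `0` is the number whose binary digits are `n` ones.
  have hcomp : Computable fun n => (2 * · + 1)^[n] 0 :=
    (Primrec.nat_iterate .id (.const 0)
      (Primrec.nat_double_succ.comp Primrec.snd).to₂).to_comp
  have hinj : Function.Injective fun n => (2 * · + 1)^[n] 0 := fun m n h => by
    simpa [trNat_iterate] using congrArg PartrecToTM2.trNat h
  obtain ⟨g, hg, hgf⟩ := exists_partrec_comp_eq hf hcomp hinj
  obtain ⟨c, hc⟩ := exists_toPartrecCode hg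
  let _ : Inhabited PartrecToTM2.Λ' := ⟨PartrecToTM2.trNormal c .halt⟩
  let _ : Fintype PartrecToTM2.K' := ⟨{.main, .rev, .aux, .stack}, by rintro (_ | _) <;> simp⟩
  obtain ⟨Λ, _, _, M, hM⟩ := exists_finite_tm0_of_tm2 PartrecToTM2.tr
    (PartrecToTM2.tr_supports c .halt) .main
  obtain ⟨a, b, hab⟩ := exists_trInit_replicate (Γ := fun _ => PartrecToTM2.Γ')
    PartrecToTM2.K'.main .cons .bit1
  refine ⟨_, Λ, inferInstance, ‹_›, (TM2to1.Γ'.fintype).finite, ‹_›, M, a, b, fun n => ?_⟩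
  rw [← hab, ← trNat_iterate, ← hgf, ← hc, ← tm2_eval_dom_iff, ← hM]
  rfl

end UnaryMachine

section Undecidability

open Nat.Partrec (Code)

theorem exists_computable_halting_sentence :
    ∃ φ : Code → HyperLTL, Computable φ ∧ ∀ c, (φ c).IsSentence ∧
      (∀ A, (c.eval 0).Dom → (φ c).lang A = ∅) ∧
      ∀ A, (φ c).props ⊆ A → IsWeakSafety ((φ c).lang A) → (c.eval 0).Dom := by
  obtain ⟨Γ, Λ, _, _, _, _, M, a, b, hM⟩ := exists_tm0_unary
    (Code.eval_part.comp (Computable.ofNat Code) (.const 0))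
  let _ : Fintype Γ := .ofFinite Γ
  let _ : Fintype Λ := .ofFinite Λ
  let _ : Encodable Γ := Fintype.toEncodable Γ
  let _ : Encodable Λ := Fintype.toEncodable Λ
  have hdom (c : Code) :
      (TM0.eval M (a :: .replicate (Encodable.encode c) b)).Dom ↔ (c.eval 0).Dom := by
    simpa only [Denumerable.ofNat_encode] using hM (Encodable.encode c)
  exact ⟨fun c => runSentence M (a :: .replicate (Encodable.encode c) b),
    (primrec_runSentence M a b).to_comp.comp .encode, fun c => ⟨isSentence_runSentence M _,
      fun A h => lang_runSentence_eq_empty_of_dom ((hdom c).2 h),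
      fun A hA h => (hdom c).1 (dom_of_isWeakSafety_lang_runSentence hA h)⟩⟩

theorem not_decidableOnSentences_of_imp_isWeakSafety {AP : HyperLTL → Set ℕ}
    (hAP : ∀ φ, φ.props ⊆ AP φ) {p : HyperLTL → Prop}
    (hempty : ∀ φ, φ.lang (AP φ) = ∅ → p φ)
    (hweak : ∀ φ, p φ → IsWeakSafety (φ.lang (AP φ))) : ¬ DecidableOnSentences p := by
  rintro ⟨q, hq, hqp⟩
  obtain ⟨φ, hφ, hhalt⟩ := exists_computable_halting_sentence
  refine ComputablePred.halting_problem 0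
    (ComputablePred.computable_of_manyOneReducible (q := q) ⟨φ, hφ, fun c => ?_⟩ hq)
  obtain ⟨hsentence, hdom, hsafe⟩ := hhalt c
  rw [hqp _ hsentence]
  exact ⟨fun h => hempty _ (hdom _ h), fun h => hsafe _ (hAP _) (hweak _ h)⟩

end Undecidability

end Hyper

theorem mainTheorem11 (AP : Hyper.HyperLTL → Set ℕ)
    (hAP : ∀ φ : Hyper.HyperLTL, φ.props ⊆ AP φ) :
    (∀ k : ℕ, ¬ Hyper.DecidableOnSentences (fun φ => Hyper.IsKSafety k (φ.lang (AP φ)))) ∧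
    (¬ Hyper.DecidableOnSentences (fun φ => ∃ k : ℕ, Hyper.IsKSafety k (φ.lang (AP φ)))) ∧
    (¬ Hyper.DecidableOnSentences (fun φ => Hyper.IsSafety (φ.lang (AP φ)))) ∧
    (¬ Hyper.DecidableOnSentences (fun φ => Hyper.IsWeakSafety (φ.lang (AP φ)))) := by
  have hkSafe (k : ℕ) (φ : Hyper.HyperLTL) (h : φ.lang (AP φ) = ∅) :
      Hyper.IsKSafety k (φ.lang (AP φ)) := h ▸ Hyper.isKSafety_empty k
  refine ⟨fun k => ?_, ?_, ?_, ?_⟩ <;> apply Hyper.not_decidableOnSentences_of_imp_isWeakSafety hAP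
  · exact hkSafe k
  · exact fun _ h => h.1.isWeakSafety
  · exact fun φ h => ⟨0, hkSafe 0 φ h⟩
  · exact fun _ ⟨_, h⟩ => h.1.isWeakSafety
  · exact fun φ h => (hkSafe 0 φ h).1
  · exact fun _ h => h.isWeakSafety
  · exact fun φ h => (hkSafe 0 φ h).1.isWeakSafety
  · exact fun _ h => h
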